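/- Let $m\ge 1$ and let $\mathbb{R}_{0,m}$ be the real Clifford algebra generated by $e_1,\dots,e_m$ with $e_j^2=-1$ and $e_je_k=-e_ke_j$ for $j\ne k$. Identify $\underline{x}\in\mathbb{R}^m$ with $\sum_{j=1}^m x_je_j$ and $\mathbb{R}^{m+1}$ with the paravectors $x=x_0+\underline{x}$. Let $R\subset\mathbb{R}^m\setminus\{0\}$ be a (finite, reduced) root system with fixed positive subsystem $R_+$, $\sigma_\alpha$ the reflection in the hyperplane $\alpha^\perp$, acting on $\underline{x}$ only, and $\kappa:R\to\mathbb{R}$ a function invariant under the reflection group of $R$. Put $\gamma_\kappa=\sum_{\alpha\in R_+}\kappa(\alpha)$ and $$T_0=\partial_{x_0},\qquad T_jf(x)=\partial_{x_j}f(x)+\sum_{\alpha\in R_+}\kappa(\alpha)\,\alpha_j\,\rho_\alpha f(x),\qquad \rho_\alpha f(x)=\frac{f(x)-f(\sigma_\alpha x)}{\langle\alpha,\underline{x}\rangle},$$ where for $\langle\alpha,\underline{x}\rangle=0$ the quotient $\rho_\alpha f(x)$ means its limit $\frac{2}{|\alpha|^2}\partial_\alpha f(x)$. Let $$D_h=\partial_{x_0}+\sum_{j=1}^m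 e_jT_j,\qquad \widetilde\Gamma_{\underline\omega}=\gamma_\kappa-\sum_{i<j}e_ie_j\,(x_i\partial_{x_j}-x_j\partial_{x_i})+\Psi,$$ $$\Psi f(x)=-\sum_{i<j}e_ie_j\sum_{\alpha\in R_+}\kappa(\alpha)\,(x_i\alpha_j-x_j\alpha_i)\,\rho_\alpha f(x)-\sum_{\alpha\in R_+}\kappa(\alpha)f(\sigma_\alpha x)$$ be the Dunkl--Cauchy--Riemann operator and the Dunkl-spherical Dirac operator. Let $K^{\rm sing}$ be the set of those $\kappa$ for which the bilinear form $[p,q]_\kappa=(p(T)q)(0)$ on the real polynomials on $\mathbb{R}^{m+1}$ is degenerate. Let $D\subset\mathbb{C}$ be open and symmetric under complex conjugation, and let $\Omega_D=\{a+\underline\omega b:\ a+ib\in D,\ \underline\omega\in\mathbb{S}^{m-1}\}\subset\mathbb{R}^{m+1}$. A stem function is a map $F=\alpha+i\beta:D\to\mathbb{R}_{0,m}\otimes\mathbb{C}$ with $F(\bar z)=\overline{F(z)}$, that is, $\alpha(\bar z)=\alpha(z)$ and $\beta(\bar z)=-\beta(z)$. It induces the slice function $f(x_0+\underline\omega r)=\alpha(x_0,r)+\underline\omega\,\beta(x_0,r)$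 on $\Omega_D$ ($r\ge0$, $\underline\omega\in\mathbb{S}^{m-1}$); a function on $\Omega_D$ is slice regular if it is induced by a stem function that is holomorphic for the complex structure given by left multiplication by $i$. Assume $\gamma_\kappa=(1-m)/2$ and $\kappa\notin K^{\rm sing}$. (a) Let $f\in\mathcal{C}^1(\Omega_D,\mathbb{R}_{0,m})$ be a slice function. Then $f$ is slice regular if and only if $D_hf=0$ on $\Omega_D$. (b) Suppose that $\Omega_D\cap\mathbb{R}\ne\emptyset$ and that every connected component of $D$ meets $\mathbb{R}$ (for instance, that $D$ is connected and meets $\mathbb{R}$). Let $f\in\mathcal{C}^1(\Omega_D,\mathbb{R}_{0,m})$. Then $f$ is slice regular if and only if $D_hf=0$ on $\Omega_D$ and $\widetilde\Gamma_{\underline\omega}f=0$ on $\Omega_D\setminus\mathbb{R}$. -/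

import Mathlib

namespace DunklSlice

noncomputable section

/-! ### The Euclidean space of vector variables and the Clifford algebra -/

/-- The space `ℝ^m` of vector variables, with its Euclidean structure. -/
abbrev V (m : ℕ) : Type := EuclideanSpace ℝ (Fin m)

/-- The space `ℝ^{m+1}` of paravectors `x = x₀ + x̲`, written as pairs `(x₀, x̲)`. -/
abbrev Para (m : ℕ) : Type := ℝ × V m

/-- The negative definite quadratic form `v ↦ -|v|²` on `ℝ^m`. -/
def negForm (m : ℕ) : QuadraticForm ℝ (V m) :=
  -(LinearMap.BilinMap.toQuadraticMap (innerₗ (V m)))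

theorem negForm_apply (m : ℕ) (v : V m) : negForm m v = -(inner ℝ v v) := rfl

/-- The real Clifford algebra `ℝ_{0,m}`: `e_j² = -1` and `e_j e_k = -e_k e_j` for `j ≠ k`. -/
abbrev Cl (m : ℕ) : Type := CliffordAlgebra (negForm m)

/-- The embedding `x̲ ↦ ∑ j, x_j e_j` of `ℝ^m` in the Clifford algebra. -/
def vec {m : ℕ} (x : V m) : Cl m := CliffordAlgebra.ι (negForm m) x

/-- The generator `e_j` of the Clifford algebra. -/
def e {m : ℕ} (j : Fin m) : Cl m := vec (EuclideanSpace.single j 1)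

theorem e_mul_self {m : ℕ} (j : Fin m) : (e j : Cl m) * e j = -1 := by
  simp [e, vec, CliffordAlgebra.ι_sq_scalar, negForm_apply]

/-- The basis of `ℝ_{0,m}` indexed by the subsets `A ⊆ {1, …, m}`. -/
def clBasis (m : ℕ) : Module.Basis (Finset (Fin m)) ℝ (Cl m) :=
  ((EuclideanSpace.basisFun (Fin m) ℝ).toBasis.ExteriorAlgebra).map
    (CliffordAlgebra.equivExterior (negForm m)).symm

/-- Components in the basis; a function is `C¹` exactly when all its components are.
The norm below (the largest absolute value of a component) serves only to give the finite
dimensional space `ℝ_{0,m}` its usual topology. -/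
def clCoord (m : ℕ) : Cl m ≃ₗ[ℝ] (Finset (Fin m) → ℝ) := (clBasis m).equivFun

instance instNormedAddCommGroupCl (m : ℕ) : NormedAddCommGroup (Cl m) :=
  NormedAddCommGroup.induced (Cl m) (Finset (Fin m) → ℝ) (clCoord m) (clCoord m).injective

instance instNormedSpaceCl (m : ℕ) : NormedSpace ℝ (Cl m) :=
  NormedSpace.induced ℝ (Cl m) (Finset (Fin m) → ℝ) (clCoord m)

/-! ### Root systems and multiplicity functions -/

/-- The reflection `σ_α` in the hyperplane orthogonal to `α`. -/
def refl {m : ℕ} (α : V m) : V m ≃ₗᵢ[ℝ] V m := (Submodule.span ℝ {α})ᗮ.reflection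

theorem refl_apply {m : ℕ} (α x : V m) :
    refl α x = x - (2 * (inner ℝ α x / ‖α‖ ^ 2)) • α := by
  rw [refl, Submodule.reflection_orthogonal_apply, Submodule.reflection_singleton_apply, neg_sub,
    mul_smul, two_smul ℝ, two_smul ℕ]
  rfl

/-- Root systems in `ℝ^m` (finite, reduced; not necessarily spanning). -/
structure IsRootSystem {m : ℕ} (R : Finset (V m)) : Prop where
  zero_notMem : (0 : V m) ∉ R
  line_inter : ∀ α ∈ R, (R : Set (V m)) ∩ (Submodule.span ℝ {α} : Set (V m)) = {α, -α}
  refl_image : ∀ α ∈ R, refl α '' (R : Set (V m)) = (R : Set (V m))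

/-- `Rp` is a positive subsystem of `R`: `R` is the disjoint union of `Rp` and `-Rp`, and these are
separated by a hyperplane through the origin. -/
structure IsPositiveSubsystem {m : ℕ} (R Rp : Finset (V m)) : Prop where
  union : (R : Set (V m)) = (Rp : Set (V m)) ∪ {α | -α ∈ Rp}
  disjoint : Disjoint (Rp : Set (V m)) {α | -α ∈ Rp}
  separated : ∃ v : V m, ∀ α ∈ Rp, 0 < inner ℝ v α

/-- The group generated by the reflections `σ_α`, `α ∈ R`. -/
def coxeterGroup {m : ℕ} (R : Finset (V m)) : Subgroup (V m ≃ₗᵢ[ℝ] V m) :=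
  Subgroup.closure {w | ∃ α ∈ R, w = refl α}

/-- `κ` is a multiplicity function on `R`: invariant under the reflection group. Only the values of
`κ` on `R` matter. -/
def IsMultiplicity {m : ℕ} (R : Finset (V m)) (κ : V m → ℝ) : Prop :=
  ∀ w ∈ coxeterGroup R, ∀ α ∈ R, κ (w α) = κ α

/-- The index `γ_κ`. -/
def gammaIndex {m : ℕ} (Rp : Finset (V m)) (κ : V m → ℝ) : ℝ := ∑ α ∈ Rp, κ α

/-! ### Dunkl operators -/

section Operators

variable {m : ℕ} {F : Type*} [NormedAddCommGroup F] [NormedSpace ℝ F]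

/-- The partial derivative `∂_{x₀}`. -/
def partial0 (f : Para m → F) (x : Para m) : F := fderiv ℝ f x (1, 0)

/-- The partial derivative `∂_{x_j}`, `j = 1, …, m`. -/
def partialV (j : Fin m) (f : Para m → F) (x : Para m) : F :=
  fderiv ℝ f x (0, EuclideanSpace.single j 1)

/-- The difference quotient `(f(x) - f(σ_α x)) / ⟨α, x⟩`. On the hyperplane `⟨α, x⟩ = 0` it stands
for its continuous extension, which for a `C¹` function is `(2 / |α|²) ∂_α f(x)`. -/
def diffQuot (α : V m) (f : Para m → F) (x : Para m) : F :=
  if inner ℝ α x.2 = 0 then (2 / ‖α‖ ^ 2) • fderiv ℝ f x (0, α)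
  else (inner ℝ α x.2)⁻¹ • (f x - f (x.1, refl α x.2))

/-- The Dunkl operators `T_0 = ∂_{x₀}, T_1, …, T_m` on functions on `ℝ^{m+1}`, for roots
in `ℝ^m`. -/
def dunklT (Rp : Finset (V m)) (κ : V m → ℝ) (i : Fin (m + 1)) (f : Para m → F) (x : Para m) : F :=
  Fin.cases (motive := fun _ => F) (partial0 f x)
    (fun j => partialV j f x + ∑ α ∈ Rp, (κ α * α j) • diffQuot α f x) i

/-- The composition `T_0^{s_0} T_1^{s_1} ⋯ T_m^{s_m}`. -/
def dunklPow (Rp : Finset (V m)) (κ : V m → ℝ) (s : Fin (m + 1) →₀ ℕ) (f : Para m → F) :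
    Para m → F :=
  (List.finRange (m + 1)).foldr (fun i g => (dunklT Rp κ i)^[s i] g) f

end Operators

/-- The function on `ℝ^{m+1}` given by a polynomial. -/
def polyFun {m : ℕ} (q : MvPolynomial (Fin (m + 1)) ℝ) (x : Para m) : ℝ :=
  MvPolynomial.eval (Fin.cons x.1 (fun j => x.2 j) : Fin (m + 1) → ℝ) q

/-- The form `[p, q]_κ = (p(T) q)(0)` on polynomials. -/
def dunklPairing {m : ℕ} (Rp : Finset (V m)) (κ : V m → ℝ)
    (p q : MvPolynomial (Fin (m + 1)) ℝ) : ℝ :=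
  ∑ s ∈ p.support, p.coeff s * dunklPow Rp κ s (polyFun q) 0

/-- The singular set `K^sing`: multiplicity functions for which `[·,·]_κ` is degenerate. -/
def singularSet {m : ℕ} (R Rp : Finset (V m)) : Set (V m → ℝ) :=
  {κ | IsMultiplicity R κ ∧
    ∃ p : MvPolynomial (Fin (m + 1)) ℝ, p ≠ 0 ∧ ∀ q, dunklPairing Rp κ p q = 0}

section Dirac

variable {m : ℕ} (Rp : Finset (V m)) (κ : V m → ℝ) (f : Para m → Cl m) (x : Para m)

/-- The Dunkl–Cauchy–Riemann operator `D_h = ∂_{x₀} + ∑ j, e_j T_j`. -/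
def dunklCR : Cl m := partial0 f x + ∑ j : Fin m, e j * dunklT Rp κ j.succ f x

/-- The spherical Dirac operator `Γ_ω = -∑_{i<j} e_i e_j (x_i ∂_{x_j} - x_j ∂_{x_i})`. -/
def sphericalDirac : Cl m :=
  -∑ i : Fin m, ∑ j ∈ Finset.Ioi i,
    e i * e j * (x.2 i • partialV j f x - x.2 j • partialV i f x)

/-- The operator `Ψ f = -∑_{i<j} e_i e_j ∑_α κ(α) (f(x) - f(σ_α x))/⟨α,x⟩ (x_i α_j - x_j α_i)
- ∑_α κ(α) f(σ_α x)`. -/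
def psiOp : Cl m :=
  -(∑ i : Fin m, ∑ j ∈ Finset.Ioi i,
      e i * e j * ∑ α ∈ Rp, (κ α * (x.2 i * α j - x.2 j * α i)) • diffQuot α f x)
    - ∑ α ∈ Rp, κ α • f (x.1, refl α x.2)

/-- The Dunkl-spherical Dirac operator `Γ̃_ω = γ_κ + Γ_ω + Ψ`. -/
def dunklSphericalDirac : Cl m :=
  gammaIndex Rp κ • f x + sphericalDirac f x + psiOp Rp κ f x

end Dirac

/-! ### Slice functions -/

/-- The circularization `Ω_D = {a + ω b : a + i b ∈ D, ω ∈ S^{m-1}}`. -/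
def circ (m : ℕ) (D : Set ℂ) : Set (Para m) :=
  {x | ∃ (a b : ℝ) (ω : V m), (⟨a, b⟩ : ℂ) ∈ D ∧ ‖ω‖ = 1 ∧ x = (a, b • ω)}

/-- `F = α + iβ : D → ℝ_{0,m} ⊗ ℂ` is a stem function. An element `α + iβ` of `ℝ_{0,m} ⊗ ℂ` is the
pair `(α, β)`, its conjugate is `(α, -β)`. -/
def IsStem {m : ℕ} (D : Set ℂ) (F : ℂ → Cl m × Cl m) : Prop :=
  ∀ z ∈ D, F (starRingEnd ℂ z) = ((F z).1, -(F z).2)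

/-- `F` is holomorphic on the open set `D` for the complex structure `i(α + iβ) = -β + iα`. -/
def IsHolomorphicStem {m : ℕ} (D : Set ℂ) (F : ℂ → Cl m × Cl m) : Prop :=
  ∀ z ∈ D, DifferentiableAt ℝ F z ∧
    ∀ w : ℂ, fderiv ℝ F z (Complex.I * w) = (-(fderiv ℝ F z w).2, (fderiv ℝ F z w).1)

/-- `f` coincides on `Ω_D` with the function induced by `F = α + iβ`:
`f(x) = α(x₀, |x̲|) + ω β(x₀, |x̲|)` for `x = x₀ + ω |x̲|`. -/
def IsInducedBy {m : ℕ} (D : Set ℂ) (F : ℂ → Cl m × Cl m) (f : Para m → Cl m) : Prop :=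
  ∀ (a r : ℝ) (ω : V m), 0 ≤ r → ‖ω‖ = 1 → (⟨a, r⟩ : ℂ) ∈ D →
    f (a, r • ω) = (F ⟨a, r⟩).1 + vec ω * (F ⟨a, r⟩).2

/-- `f` is a slice function on `Ω_D`. -/
def IsSlice {m : ℕ} (D : Set ℂ) (f : Para m → Cl m) : Prop :=
  ∃ F : ℂ → Cl m × Cl m, IsStem D F ∧ IsInducedBy D F f

/-- `f` is slice regular on `Ω_D`: induced by a holomorphic stem function. -/
def IsSliceRegular {m : ℕ} (D : Set ℂ) (f : Para m → Cl m) : Prop :=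
  ∃ F : ℂ → Cl m × Cl m, IsStem D F ∧ IsHolomorphicStem D F ∧ IsInducedBy D F f

end

end DunklSlice

open DunklSlice

namespace DunklSlice

noncomputable section

/-! ### Clifford multiplication by vectors -/

section Clifford

variable {m : ℕ}

/-! Multiplying the Dunkl–Dirac operator by `x̲` and separating the terms `e_j² = -1` from those
with `i < j` gives, for every `κ`, the polar identity `x̲ ∑ e_j T_j f = -(E f + Γ̃ f)`, where `E f`
is the derivative of `f` along `x̲` (`vec_mul_dunklDirac`). Hence off the real axis `D_h f = ∂₀ f +
|x̲|⁻² x̲ (E f + Γ̃ f)`.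

A slice function has the form `c + v g` on each sphere `|v| = |x̲|`. Its tangential derivatives and
its difference quotients are therefore explicit, and they contribute `-(m + 2γ_κ) g` to the Dirac
operator (`dunklCR_eq_of_fderiv`). For `m + 2γ_κ = 1` this cancels against the `g` left over from
the radial part, so `D_h f = ∂₀ f + |x̲|⁻² x̲ E f`: the Cauchy–Riemann operator of the plane through
`x`. This proves (a), after passing to real points by continuity. Comparison with the polar identity
gives `Γ̃ f = 0`.

Conversely, `D_h f = 0` and `Γ̃ f = 0` leave the Cauchy–Riemann equation on every plane. The values
on the planes of `±J` define a holomorphic stem function. It induces `f` on the other planes by the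
identity principle, since all planes share the real axis and every component of `D` meets it
(`isInducedBy_planeStem`). -/

instance instFiniteDimensionalCl (m : ℕ) : FiniteDimensional ℝ (Cl m) :=
  Module.Finite.of_basis (clBasis m)

theorem vec_add (u v : V m) : (vec (u + v) : Cl m) = vec u + vec v := map_add _ _ _

theorem vec_smul (c : ℝ) (v : V m) : (vec (c • v) : Cl m) = c • vec v := map_smul _ _ _

theorem vec_neg (v : V m) : (vec (-v) : Cl m) = -vec v := map_neg _ _

theorem vec_sub (u v : V m) : (vec (u - v) : Cl m) = vec u - vec v := map_sub _ _ _

theorem vec_zero : (vec (0 : V m) : Cl m) = 0 := map_zero _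

theorem vec_mul_self (v : V m) : (vec v : Cl m) * vec v = -(‖v‖ ^ 2) • (1 : Cl m) := by
  rw [vec, CliffordAlgebra.ι_sq_scalar, negForm_apply, real_inner_self_eq_norm_sq,
    Algebra.algebraMap_eq_smul_one]

theorem vec_mul_vec_mul (v : V m) (c : Cl m) : vec v * (vec v * c) = -(‖v‖ ^ 2) • c := by
  rw [← mul_assoc, vec_mul_self, smul_one_mul]

theorem vec_mul_vec_mul_of_norm_eq_one {v : V m} (hv : ‖v‖ = 1) (c : Cl m) :
    vec v * (vec v * c) = -c := by
  rw [vec_mul_vec_mul, hv]; simp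

theorem eq_sum_smul_single (v : V m) : v = ∑ j, v j • EuclideanSpace.single j (1 : ℝ) := by
  ext k
  simp [Finset.sum_apply, Pi.single_apply]

theorem vec_eq_sum (v : V m) : (vec v : Cl m) = ∑ j, v j • e j := by
  conv_lhs => rw [eq_sum_smul_single v, vec, map_sum]
  simp only [map_smul]
  rfl

theorem e_mul_e_swap {i j : Fin m} (h : i ≠ j) : (e j : Cl m) * e i = -(e i * e j) := by
  rw [eq_neg_iff_add_eq_zero]
  refine CliffordAlgebra.ι_mul_ι_add_swap_of_isOrtho ?_
  rw [QuadraticMap.isOrtho_def]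
  simp only [negForm_apply, inner_add_left, inner_add_right]
  simp [EuclideanSpace.inner_single_left, h, h.symm]

/-- The diagonal terms collapse by `e_j² = -1`; the others pair up by anticommutation. With `t j =
T_j f`, the two sums become the radial and the spherical part of the Dunkl–Dirac operator. -/
theorem vec_mul_sum_e_mul (v : V m) (t : Fin m → Cl m) :
    vec v * ∑ j, e j * t j = -∑ j, v j • t j +
      ∑ i, ∑ j ∈ Finset.Ioi i, e i * e j * (v i • t j - v j • t i) := by
  have h1 : vec v * ∑ j, e j * t j = ∑ i, ∑ j, v i • (e i * (e j * t j)) := by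
    rw [vec_eq_sum, Finset.sum_mul]
    simp only [Finset.mul_sum, smul_mul_assoc]
  have h2 : ∀ i : Fin m, ∑ j ∈ Finset.Ioi i, e i * e j * (v i • t j - v j • t i) =
      ∑ j ∈ Finset.Ioi i, (v j • (e j * (e i * t i)) + v i • (e i * (e j * t j))) := by
    refine fun i => Finset.sum_congr rfl fun j hj => ?_
    have hij : i ≠ j := (Finset.mem_Ioi.1 hj).ne
    rw [← mul_assoc (e j), e_mul_e_swap hij, mul_sub, mul_smul_comm, mul_smul_comm, neg_mul,
      smul_neg, sub_eq_neg_add, mul_assoc, mul_assoc]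
  rw [h1, Finset.sum_congr rfl fun i _ => h2 i,
    Finset.sum_sum_Ioi_add_eq_sum_sum_off_diag (fun i j => v i • (e i * (e j * t j)))]
  rw [Finset.sum_comm, ← Finset.sum_neg_distrib, ← Finset.sum_add_distrib]
  refine Finset.sum_congr rfl fun i _ => ?_
  rw [Fintype.sum_eq_add_sum_compl i, ← mul_assoc (e i), e_mul_self, neg_one_mul, smul_neg]

end Clifford

/-! ### Polar form of the Dunkl operators -/

section Operators

variable {m : ℕ} {Rp : Finset (V m)} {κ : V m → ℝ}

theorem sum_smul_partialV (f : Para m → Cl m) (x : Para m) (v : V m) :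
    ∑ j, v j • partialV j f x = fderiv ℝ f x (0, v) := by
  have h : ((0, v) : Para m) = ∑ j, v j • ((0, EuclideanSpace.single j 1) : Para m) := by
    simp only [Prod.smul_mk, smul_zero]
    rw [Prod.ext_iff]
    simp only [Prod.fst_sum, Prod.snd_sum, Finset.sum_const_zero, true_and]
    exact eq_sum_smul_single v
  rw [h, map_sum]
  simp only [map_smul, partialV]

/-- On the hyperplane both sides vanish because `σ_α` fixes `x`, so the convention made there plays
no role. -/
theorem inner_smul_diffQuot (α : V m) (f : Para m → Cl m) (x : Para m) :
    inner ℝ α x.2 • diffQuot α f x = f x - f (x.1, refl α x.2) := by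
  unfold diffQuot
  split_ifs with h
  · simp [refl_apply, h]
  · rw [smul_inv_smul₀ h]

theorem dunklT_succ (f : Para m → Cl m) (x : Para m) (j : Fin m) :
    dunklT Rp κ j.succ f x =
      partialV j f x + ∑ α ∈ Rp, (κ α * α j) • diffQuot α f x := rfl

theorem inner_eq_sum (u v : V m) : inner ℝ u v = ∑ j, u j * v j := by
  simp [PiLp.inner_apply, mul_comm]

/-- The last sum is the source of the terms `γ_κ f` and `-∑ κ(α) f(σ_α x)` of `Γ̃`. -/
theorem sum_smul_dunklT (f : Para m → Cl m) (x : Para m) :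
    ∑ j, x.2 j • dunklT Rp κ j.succ f x =
      fderiv ℝ f x (0, x.2) + ∑ α ∈ Rp, κ α • (f x - f (x.1, refl α x.2)) := by
  simp only [dunklT_succ, smul_add, Finset.sum_add_distrib, sum_smul_partialV, Finset.smul_sum]
  rw [Finset.sum_comm]
  congr 1
  refine Finset.sum_congr rfl fun α _ => ?_
  rw [← inner_smul_diffQuot, inner_eq_sum, Finset.sum_smul, Finset.smul_sum]
  refine Finset.sum_congr rfl fun j _ => ?_
  simp only [smul_smul]
  ring_nf

/-- The polar decomposition of the Dunkl–Dirac operator. -/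
theorem vec_mul_dunklDirac (f : Para m → Cl m) (x : Para m) :
    vec x.2 * ∑ j, e j * dunklT Rp κ j.succ f x =
      -(fderiv ℝ f x (0, x.2) + dunklSphericalDirac Rp κ f x) := by
  rw [vec_mul_sum_e_mul, sum_smul_dunklT, dunklSphericalDirac, sphericalDirac, psiOp, gammaIndex]
  have h : ∀ i j : Fin m, x.2 i • dunklT Rp κ j.succ f x - x.2 j • dunklT Rp κ i.succ f x =
      (x.2 i • partialV j f x - x.2 j • partialV i f x) +
        ∑ α ∈ Rp, (κ α * (x.2 i * α j - x.2 j * α i)) • diffQuot α f x := by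
    intro i j
    have : ∀ α : V m, (κ α * (x.2 i * α j - x.2 j * α i)) • diffQuot α f x =
        x.2 i • (κ α * α j) • diffQuot α f x - x.2 j • (κ α * α i) • diffQuot α f x := by
      intro α
      rw [smul_smul, smul_smul, ← sub_smul]
      ring_nf
    simp only [this, dunklT_succ, smul_add, Finset.smul_sum, Finset.sum_sub_distrib]
    abel
  simp only [h, mul_add, Finset.sum_add_distrib, smul_sub, Finset.sum_sub_distrib, Finset.sum_smul]
  abel

/-- The Dunkl–Cauchy–Riemann operator on functions with the first order behaviour of a slice
function. -/
theorem dunklCR_eq_of_fderiv (h0 : ∀ α ∈ Rp, α ≠ 0) (hγ : gammaIndex Rp κ = (1 - (m : ℝ)) / 2)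
    {f : Para m → Cl m} {x : Para m} {A g : Cl m}
    (hf : ∀ w, fderiv ℝ f x (0, w) = (inner ℝ x.2 w : ℝ) • A + vec w * g)
    (hq : ∀ α ∈ Rp, diffQuot α f x = (2 / ‖α‖ ^ 2) • (vec α * g)) :
    dunklCR Rp κ f x = partial0 f x + (vec x.2 * A - g) := by
  have h1 : ∑ j, e j * partialV j f x = vec x.2 * A - (m : ℝ) • g := by
    have : ∀ j : Fin m, e j * partialV j f x = (x.2 j • e j) * A + -g := by
      intro j
      rw [partialV, hf, EuclideanSpace.inner_single_right, mul_add]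
      congr 1
      · simp
      · change e j * (e j * g) = _
        rw [← mul_assoc, e_mul_self, neg_one_mul]
    simp only [this, Finset.sum_add_distrib, ← Finset.sum_mul, ← vec_eq_sum]
    simp [sub_eq_add_neg, Nat.cast_smul_eq_nsmul]
  -- Each root contributes `κ(α) (2/|α|²) α α g = -2 κ(α) g`.
  have h2 : ∑ j, e j * ∑ α ∈ Rp, (κ α * α j) • diffQuot α f x = -(2 * gammaIndex Rp κ) • g := by
    simp only [Finset.mul_sum]
    rw [Finset.sum_comm, gammaIndex, Finset.mul_sum, ← Finset.sum_neg_distrib, Finset.sum_smul]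
    refine Finset.sum_congr rfl fun α hα => ?_
    have : ∀ j, e j * (κ α * α j) • diffQuot α f x = κ α • ((α j • e j) * diffQuot α f x) := by
      intro j
      rw [mul_smul_comm, smul_mul_assoc, smul_smul]
    simp only [this]
    rw [← Finset.smul_sum, ← Finset.sum_mul, ← vec_eq_sum, hq α hα, mul_smul_comm, vec_mul_vec_mul,
      smul_smul, smul_smul]
    congr 1
    have : ‖α‖ ≠ 0 := norm_ne_zero_iff.2 (h0 α hα)
    field_simp
  rw [dunklCR]
  simp only [dunklT_succ, mul_add, Finset.sum_add_distrib]
  rw [h1, h2, hγ, sub_add, ← sub_smul]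
  congr 2
  -- The choice of index enters here: `m + 2γ_κ = 1` leaves one copy of `g`.
  rw [show (m : ℝ) - -(2 * ((1 - (m : ℝ)) / 2)) = 1 by ring, one_smul]

end Operators

/-! ### Holomorphy on planes, stem functions and the identity principle -/

section Planes

open Filter Topology

variable {m : ℕ}

/-- Left multiplication as a continuous linear map. -/
def mulLeftL (c : Cl m) : Cl m →L[ℝ] Cl m := LinearMap.toContinuousLinearMap (LinearMap.mulLeft ℝ c)

theorem mulLeftL_apply (c x : Cl m) : mulLeftL c x = c * x := rfl

/-- The parametrization `a + ib ↦ a + ωb` of the plane spanned by `1` and `ω`. -/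
def plane (ω : V m) : ℂ →L[ℝ] Para m :=
  Complex.reCLM.prod (Complex.imCLM.smulRight ω)

theorem plane_apply (ω : V m) (z : ℂ) : plane ω z = (z.re, z.im • ω) := rfl

theorem plane_neg (ω : V m) (z : ℂ) : plane (-ω) z = plane ω (starRingEnd ℂ z) := by
  simp [plane_apply]

theorem plane_one (ω : V m) : plane ω 1 = (1, 0) := by simp [plane_apply]

theorem plane_I (ω : V m) : plane ω Complex.I = (0, ω) := by simp [plane_apply]

theorem plane_mem_circ {D : Set ℂ} {ω : V m} (hω : ‖ω‖ = 1) {z : ℂ} (hz : z ∈ D) :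
    plane ω z ∈ circ m D := ⟨z.re, z.im, ω, hz, hω, rfl⟩

theorem exists_plane_of_mem_circ {D : Set ℂ} {x : Para m} (hx : x ∈ circ m D) :
    ∃ ω : V m, ‖ω‖ = 1 ∧ ∃ z ∈ D, x = plane ω z := by
  obtain ⟨a, b, ω, hD, hω, rfl⟩ := hx
  exact ⟨ω, hω, _, hD, rfl⟩

theorem exists_norm_smul_eq (hm : m ≠ 0) (v : V m) : ∃ ω : V m, ‖ω‖ = 1 ∧ v = ‖v‖ • ω := by
  by_cases hv : v = 0
  · exact ⟨EuclideanSpace.single ⟨0, Nat.pos_of_ne_zero hm⟩ 1, by simp, by simp [hv]⟩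
  · have : ‖v‖ ≠ 0 := norm_ne_zero_iff.2 hv
    exact ⟨‖v‖⁻¹ • v, by simp [norm_smul, this], by rw [smul_inv_smul₀ this]⟩

theorem mem_circ_iff (hm : m ≠ 0) {D : Set ℂ} (hsymm : ∀ z ∈ D, starRingEnd ℂ z ∈ D) (x : Para m) :
    x ∈ circ m D ↔ (⟨x.1, ‖x.2‖⟩ : ℂ) ∈ D := by
  constructor
  · rintro ⟨a, b, ω, hD, hω, rfl⟩
    simp only [norm_smul, hω, mul_one, Real.norm_eq_abs]
    rcases abs_choice b with h | h <;> rw [h]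
    · exact hD
    · exact hsymm _ hD
  · intro h
    obtain ⟨ω, hω, hx⟩ := exists_norm_smul_eq hm x.2
    exact ⟨x.1, ‖x.2‖, ω, h, hω, Prod.ext rfl hx⟩

theorem isOpen_circ (hm : m ≠ 0) {D : Set ℂ} (hD : IsOpen D)
    (hsymm : ∀ z ∈ D, starRingEnd ℂ z ∈ D) : IsOpen (circ m D) := by
  have h : circ m D = (fun x : Para m => (x.1 : ℂ) + (‖x.2‖ : ℂ) * Complex.I) ⁻¹' D := by
    ext x
    rw [mem_circ_iff hm hsymm, Set.mem_preimage, Complex.mk_eq_add_mul_I]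
  rw [h]
  exact hD.preimage (by fun_prop)

/-- The restriction of `f` to the plane of `ω` is holomorphic at `z` for the left multiplication
by `ω`. -/
def IsSliceHolomorphicAt (f : Para m → Cl m) (ω : V m) (z : ℂ) : Prop :=
  fderiv ℝ f (plane ω z) (0, ω) = vec ω * fderiv ℝ f (plane ω z) (1, 0)

theorem hasFDerivAt_comp_plane {f : Para m → Cl m} {ω : V m} {z : ℂ}
    (hf : DifferentiableAt ℝ f (plane ω z)) :
    HasFDerivAt (fun z => f (plane ω z)) ((fderiv ℝ f (plane ω z)).comp (plane ω)) z :=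
  hf.hasFDerivAt.comp z (plane ω).hasFDerivAt

theorem fderiv_plane_apply (f : Para m → Cl m) (ω : V m) (z w : ℂ) :
    fderiv ℝ f (plane ω z) (plane ω w) =
      w.re • fderiv ℝ f (plane ω z) (1, 0) + w.im • fderiv ℝ f (plane ω z) (0, ω) := by
  rw [← map_smul, ← map_smul, ← map_add]
  simp [plane_apply]

theorem IsSliceHolomorphicAt.fderiv_plane_apply {f : Para m → Cl m} {ω : V m} {z : ℂ}
    (h : IsSliceHolomorphicAt f ω z) (w : ℂ) :
    fderiv ℝ f (plane ω z) (plane ω w) =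
      w.re • fderiv ℝ f (plane ω z) (1, 0) +
        w.im • (vec ω * fderiv ℝ f (plane ω z) (1, 0)) := by
  rw [DunklSlice.fderiv_plane_apply, h]

theorem IsInducedBy.plane_eq {D : Set ℂ} (hsymm : ∀ z ∈ D, starRingEnd ℂ z ∈ D)
    {F : ℂ → Cl m × Cl m} {f : Para m → Cl m} (hF : IsStem D F) (hf : IsInducedBy D F f)
    {ω : V m} (hω : ‖ω‖ = 1) {z : ℂ} (hz : z ∈ D) :
    f (plane ω z) = (F z).1 + vec ω * (F z).2 := by
  rcases le_total 0 z.im with h | h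
  · exact hf z.re z.im ω h hω hz
  -- In the lower half plane the same point is represented by `-ω` and the conjugate of `z`.
  · have := hf z.re (-z.im) (-ω) (neg_nonneg.2 h) (by rwa [norm_neg]) (hsymm z hz)
    have hF' : F ⟨z.re, -z.im⟩ = ((F z).1, -(F z).2) := hF z hz
    rw [hF', neg_smul_neg, vec_neg, neg_mul_neg] at this
    exact this

theorem IsSliceRegular.isSlice {D : Set ℂ} {f : Para m → Cl m} (h : IsSliceRegular D f) :
    IsSlice D f := by
  obtain ⟨F, hF, -, hf⟩ := h
  exact ⟨F, hF, hf⟩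

theorem IsSliceRegular.isSliceHolomorphicAt {D : Set ℂ} (hD : IsOpen D)
    (hsymm : ∀ z ∈ D, starRingEnd ℂ z ∈ D) {f : Para m → Cl m} (h : IsSliceRegular D f)
    {ω : V m} (hω : ‖ω‖ = 1) {z : ℂ} (hz : z ∈ D) (hfd : DifferentiableAt ℝ f (plane ω z)) :
    IsSliceHolomorphicAt f ω z := by
  obtain ⟨F, hF, hhol, hf⟩ := h
  obtain ⟨hd, hI⟩ := hhol z hz
  have h1 : HasFDerivAt (fun z => (F z).1 + vec ω * (F z).2)
      ((ContinuousLinearMap.fst ℝ (Cl m) (Cl m)).comp (fderiv ℝ F z) +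
        (mulLeftL (vec ω)).comp
          ((ContinuousLinearMap.snd ℝ (Cl m) (Cl m)).comp (fderiv ℝ F z))) z :=
    hd.hasFDerivAt.fst.add ((mulLeftL (vec ω)).hasFDerivAt.comp z hd.hasFDerivAt.snd)
  have h2 : (fun z => (F z).1 + vec ω * (F z).2) =ᶠ[𝓝 z] fun z => f (plane ω z) := by
    filter_upwards [hD.mem_nhds hz] with y hy
    exact (hf.plane_eq hsymm hF hω hy).symm
  have h3 := (hasFDerivAt_comp_plane hfd).unique (h1.congr_of_eventuallyEq h2.symm)
  have h4 := hI 1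
  have e1 := DFunLike.congr_fun h3 1
  have e2 := DFunLike.congr_fun h3 Complex.I
  simp only [ContinuousLinearMap.comp_apply, _root_.add_apply, mulLeftL_apply,
    ContinuousLinearMap.coe_fst', ContinuousLinearMap.coe_snd', plane_one, plane_I] at e1 e2
  rw [mul_one] at h4
  rw [IsSliceHolomorphicAt, e1, e2, h4, mul_add, vec_mul_vec_mul_of_norm_eq_one hω, add_comm]

/-- By continuity, slice holomorphy extends to the real points. -/
theorem isSliceHolomorphicAt_of_im_ne_zero {D : Set ℂ} (hD : IsOpen D) {f : Para m → Cl m}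
    {ω : V m} (hω : ‖ω‖ = 1) (hc : ContinuousOn (fderiv ℝ f) (circ m D))
    (ho : IsOpen (circ m D))
    (h : ∀ z ∈ D, z.im ≠ 0 → IsSliceHolomorphicAt f ω z) {z : ℂ} (hz : z ∈ D) :
    IsSliceHolomorphicAt f ω z := by
  by_cases hz0 : z.im = 0
  swap
  · exact h z hz hz0
  have hp : Tendsto (fun t : ℝ => z + t * Complex.I) (𝓝[≠] 0) (𝓝 z) := by
    have : Continuous (fun t : ℝ => z + t * Complex.I) := by fun_prop
    simpa using (this.tendsto 0).mono_left nhdsWithin_le_nhds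
  have hL : Tendsto (fun t : ℝ => fderiv ℝ f (plane ω (z + t * Complex.I))) (𝓝[≠] 0)
      (𝓝 (fderiv ℝ f (plane ω z))) :=
    ((hc.continuousAt (ho.mem_nhds (plane_mem_circ hω hz))).tendsto.comp
      ((plane ω).continuous.tendsto z)).comp hp
  have h1 := ((ContinuousLinearMap.apply ℝ (Cl m) ((0, ω) : Para m)).continuous.tendsto _).comp hL
  have h2 := (((mulLeftL (vec ω)).comp
    (ContinuousLinearMap.apply ℝ (Cl m) ((1, 0) : Para m))).continuous.tendsto _).comp hL
  refine tendsto_nhds_unique h1 (h2.congr' ?_)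
  filter_upwards [hp (hD.mem_nhds hz), self_mem_nhdsWithin] with t ht ht0
  refine (h _ ht ?_).symm
  simpa [hz0] using ht0

/-- The stem function that represents `f` through its values on the plane of `J`. -/
def planeStem (f : Para m → Cl m) (J : V m) (z : ℂ) : Cl m × Cl m :=
  ((1 / 2 : ℝ) • (f (plane J z) + f (plane (-J) z)),
    (1 / 2 : ℝ) • (vec J * (f (plane (-J) z) - f (plane J z))))

theorem isStem_planeStem (D : Set ℂ) (f : Para m → Cl m) (J : V m) : IsStem D (planeStem f J) := by
  intro z _
  simp only [planeStem, plane_neg, Complex.conj_conj]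
  rw [add_comm (f _), ← smul_neg, ← mul_neg, neg_sub]

/-- On `D` a stem function is determined by `f`, so it inherits the regularity of `f`. -/
theorem planeStem_of_isInducedBy {D : Set ℂ} (hsymm : ∀ z ∈ D, starRingEnd ℂ z ∈ D)
    {F : ℂ → Cl m × Cl m} {f : Para m → Cl m} (hF : IsStem D F) (hf : IsInducedBy D F f)
    {J : V m} (hJ : ‖J‖ = 1) {z : ℂ} (hz : z ∈ D) : planeStem f J z = F z := by
  have h1 := hf.plane_eq hsymm hF hJ hz
  have h2 := hf.plane_eq hsymm hF (ω := -J) (by rwa [norm_neg]) hz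
  refine Prod.ext ?_ ?_
  · rw [planeStem, h1, h2, vec_neg, neg_mul, add_add_add_comm, add_neg_cancel, add_zero, ← two_smul ℝ,
      smul_smul]
    norm_num
  · simp only [planeStem, h1, h2, vec_neg, neg_mul, add_sub_add_left_eq_sub, mul_sub, mul_neg,
      vec_mul_vec_mul_of_norm_eq_one hJ]
    module

theorem hasFDerivAt_planeStem {f : Para m → Cl m} {J : V m} {z : ℂ}
    (hf : DifferentiableAt ℝ f (plane J z)) (hf' : DifferentiableAt ℝ f (plane (-J) z)) :
    HasFDerivAt (planeStem f J)
      (((1 / 2 : ℝ) • ((fderiv ℝ f (plane J z)).comp (plane J) +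
        (fderiv ℝ f (plane (-J) z)).comp (plane (-J)))).prod
      ((1 / 2 : ℝ) • (mulLeftL (vec J)).comp ((fderiv ℝ f (plane (-J) z)).comp (plane (-J)) -
        (fderiv ℝ f (plane J z)).comp (plane J)))) z := by
  have h1 := hasFDerivAt_comp_plane hf
  have h2 := hasFDerivAt_comp_plane hf'
  exact ((h1.add h2).const_smul (1 / 2 : ℝ)).prodMk
    (((mulLeftL (vec J)).hasFDerivAt.comp z (h2.sub h1)).const_smul (1 / 2 : ℝ))

/-- On the planes of `±J` the function is `α ± Jβ`, holomorphic for `±J`. Half the sum and half the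
difference of these two equations are the Cauchy–Riemann equations for `(α, β)`. -/
theorem isHolomorphicStem_planeStem {D : Set ℂ} {f : Para m → Cl m}
    (hf : ∀ x ∈ circ m D, DifferentiableAt ℝ f x) {J : V m} (hJ : ‖J‖ = 1)
    (h : ∀ ω : V m, ‖ω‖ = 1 → ∀ z ∈ D, IsSliceHolomorphicAt f ω z) :
    IsHolomorphicStem D (planeStem f J) := by
  intro z hz
  have hJ' : ‖-J‖ = 1 := by rwa [norm_neg]
  have hd := hasFDerivAt_planeStem (hf _ (plane_mem_circ hJ hz)) (hf _ (plane_mem_circ hJ' hz))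
  refine ⟨hd.differentiableAt, fun w => ?_⟩
  rw [hd.fderiv]
  simp only [ContinuousLinearMap.prod_apply, _root_.smul_apply,
    _root_.add_apply, ContinuousLinearMap.comp_apply, _root_.sub_apply,
    mulLeftL_apply, (h J hJ z hz).fderiv_plane_apply, (h (-J) hJ' z hz).fderiv_plane_apply,
    Complex.I_mul_re, Complex.I_mul_im, vec_neg, neg_mul]
  generalize fderiv ℝ f (plane J z) (1, 0) = P
  generalize fderiv ℝ f (plane (-J) z) (1, 0) = Q
  refine Prod.ext ?_ ?_ <;>
  simp only [mul_add, mul_sub, mul_smul_comm, mul_neg, vec_mul_vec_mul_of_norm_eq_one hJ] <;> module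

/-- The identity principle on the planes: a slice holomorphic function is a slice function. -/
theorem isInducedBy_planeStem {D : Set ℂ} (hD : IsOpen D)
    (hcc : ∀ z ∈ D, ∃ t : ℝ, (t : ℂ) ∈ connectedComponentIn D z) {f : Para m → Cl m}
    (hf : ∀ x ∈ circ m D, DifferentiableAt ℝ f x) {J : V m} (hJ : ‖J‖ = 1)
    (h : ∀ ω : V m, ‖ω‖ = 1 → ∀ z ∈ D, IsSliceHolomorphicAt f ω z) :
    IsInducedBy D (planeStem f J) f := by
  intro a r ω _ hω hz
  set d : ℂ → Cl m := fun z =>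
    f (plane ω z) - ((planeStem f J z).1 + vec ω * (planeStem f J z).2) with hd
  have hhol := isHolomorphicStem_planeStem hf hJ h
  have hdd : ∀ z ∈ D, HasFDerivAt d ((fderiv ℝ f (plane ω z)).comp (plane ω) -
      ((ContinuousLinearMap.fst ℝ (Cl m) (Cl m)).comp (fderiv ℝ (planeStem f J) z) +
        (mulLeftL (vec ω)).comp ((ContinuousLinearMap.snd ℝ (Cl m) (Cl m)).comp
          (fderiv ℝ (planeStem f J) z)))) z := by
    intro z hz
    have hF := (hhol z hz).1.hasFDerivAt
    exact (hasFDerivAt_comp_plane (hf _ (plane_mem_circ hω hz))).sub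
      (hF.fst.add ((mulLeftL (vec ω)).hasFDerivAt.comp z hF.snd))
  have hdI : ∀ z ∈ D, fderiv ℝ d z Complex.I = vec ω * fderiv ℝ d z 1 := by
    intro z hz
    have h1 := (hhol z hz).2 1
    have h2 := h ω hω z hz
    rw [mul_one] at h1
    rw [(hdd z hz).fderiv]
    simp only [_root_.sub_apply, _root_.add_apply,
      ContinuousLinearMap.comp_apply, mulLeftL_apply, ContinuousLinearMap.coe_fst',
      ContinuousLinearMap.coe_snd', plane_one, plane_I, h1]
    rw [h2, mul_sub, mul_add, vec_mul_vec_mul_of_norm_eq_one hω]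
    abel
  -- All planes meet in the real axis, where `β` vanishes and `α = f`.
  have hreal : ∀ t : ℝ, d t = 0 := by
    intro t
    have h1 : ∀ ω : V m, plane ω (t : ℂ) = (t, 0) := fun ω => by simp [plane_apply]
    simp only [hd, planeStem, h1, sub_self, mul_zero, smul_zero, add_zero]
    module
  suffices hd0 : d ⟨a, r⟩ = 0 from sub_eq_zero.1 hd0
  obtain ⟨t, ht⟩ := hcc _ hz
  set C := connectedComponentIn D (⟨a, r⟩ : ℂ)
  have hCD : C ⊆ D := connectedComponentIn_subset _ _
  have hCo : IsOpen C := hD.connectedComponentIn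
  have key : ∀ φ : Cl m →L[ℝ] ℝ, φ (d ⟨a, r⟩) = 0 := by
    intro φ
    -- As `∂_y d = ω ∂_x d` and `ω² = -1`, this combination satisfies `∂_y u = i ∂_x u`. The scalar
    -- identity theorem then applies, and `Re u = φ ∘ d`.
    set u : ℂ → ℂ := fun z => (φ (d z) : ℂ) - Complex.I * (φ (vec ω * d z) : ℂ) with hu
    have hud : DifferentiableOn ℂ u C := by
      intro z hzC
      have hzD := hCD hzC
      have h1 := (hdd z hzD).differentiableAt.hasFDerivAt
      have h2 : HasFDerivAt (fun z => ((φ (d z) : ℝ) : ℂ))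
          (Complex.ofRealCLM.comp (φ.comp (fderiv ℝ d z))) z :=
        Complex.ofRealCLM.hasFDerivAt.comp z (φ.hasFDerivAt.comp z h1)
      have h3 : HasFDerivAt (fun z => ((φ (vec ω * d z) : ℝ) : ℂ))
          (Complex.ofRealCLM.comp (φ.comp ((mulLeftL (vec ω)).comp (fderiv ℝ d z)))) z :=
        Complex.ofRealCLM.hasFDerivAt.comp z (φ.hasFDerivAt.comp z
          ((mulLeftL (vec ω)).hasFDerivAt.comp z h1))
      have h4 := h2.sub (h3.const_mul Complex.I)
      refine (differentiableAt_complex_iff_differentiableAt_real.2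
        ⟨h4.differentiableAt, ?_⟩).differentiableWithinAt
      rw [HasFDerivAt.fderiv h4]
      simp only [_root_.sub_apply, _root_.smul_apply,
        ContinuousLinearMap.comp_apply, mulLeftL_apply, Complex.ofRealCLM_apply, hdI z hzD,
        vec_mul_vec_mul_of_norm_eq_one hω, map_neg, smul_eq_mul]
      rw [mul_sub, ← mul_assoc, Complex.I_mul_I]
      ring
    have hfreq : ∃ᶠ z in 𝓝[≠] (t : ℂ), u z = 0 := by
      have h1 : Tendsto (fun s : ℝ => (s : ℂ)) (𝓝[≠] t) (𝓝[≠] (t : ℂ)) :=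
        Complex.continuous_ofReal.continuousAt.continuousWithinAt.tendsto_nhdsWithin
          fun s hs => by simpa using hs
      refine h1.frequently (Eventually.frequently (Eventually.of_forall fun s => ?_))
      simp [hu, hreal s]
    have h0 := (hud.analyticOnNhd hCo).eqOn_zero_of_preconnected_of_frequently_eq_zero
      isPreconnected_connectedComponentIn ht hfreq (mem_connectedComponentIn hz)
    have := congrArg Complex.re h0
    simpa [hu] using this
  refine (clBasis m).equivFun.injective (funext fun i => ?_)
  rw [map_zero]
  exact key (LinearMap.toContinuousLinearMap ((clBasis m).coord i))

end Planes

/-! ### The Dunkl operators on slice functions -/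

section SliceDunkl

variable {m : ℕ} {Rp : Finset (V m)} {κ : V m → ℝ}

/-- For `|u| = |x̲|` the curve `cos t x̲ + sin t u` stays on the sphere where `f` is affine; other
tangent vectors follow by scaling. -/
theorem fderiv_apply_of_orthogonal {f : Para m → Cl m} {x : Para m} {c g : Cl m} (hx : x.2 ≠ 0)
    (hfd : DifferentiableAt ℝ f x) (hf : ∀ v : V m, ‖v‖ = ‖x.2‖ → f (x.1, v) = c + vec v * g)
    {w : V m} (hw : inner ℝ x.2 w = 0) : fderiv ℝ f x (0, w) = vec w * g := by
  have hx' : ‖x.2‖ ≠ 0 := norm_ne_zero_iff.2 hx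
  have key : ∀ u : V m, inner ℝ x.2 u = 0 → ‖u‖ = ‖x.2‖ → fderiv ℝ f x (0, u) = vec u * g := by
    intro u hu hnu
    have hγ : HasDerivAt (fun t : ℝ => (x.1, Real.cos t • x.2 + Real.sin t • u)) ((0, u) : Para m)
        0 := by
      refine (hasDerivAt_const _ _).prodMk ?_
      have := ((Real.hasDerivAt_cos 0).smul_const x.2).add ((Real.hasDerivAt_sin 0).smul_const u)
      refine this.congr_deriv ?_
      simp
    have h0 : ((x.1, Real.cos 0 • x.2 + Real.sin 0 • u) : Para m) = x := by simp
    have h1 : HasDerivAt (fun t : ℝ => f (x.1, Real.cos t • x.2 + Real.sin t • u))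
        (fderiv ℝ f x (0, u)) 0 :=
      HasFDerivAt.comp_hasDerivAt (0 : ℝ) (by rw [h0]; exact hfd.hasFDerivAt) hγ
    have h2 : (fun t : ℝ => f (x.1, Real.cos t • x.2 + Real.sin t • u)) =
        fun t : ℝ => c + (Real.cos t • (vec x.2 * g) + Real.sin t • (vec u * g)) := by
      funext t
      rw [hf, vec_add, vec_smul, vec_smul, add_mul, smul_mul_assoc, smul_mul_assoc]
      refine (sq_eq_sq₀ (norm_nonneg _) (norm_nonneg _)).1 ?_
      rw [norm_add_sq_real, norm_smul, norm_smul, inner_smul_left, inner_smul_right, hu, hnu,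
        mul_pow, mul_pow, Real.norm_eq_abs, Real.norm_eq_abs, sq_abs, sq_abs]
      linear_combination ‖x.2‖ ^ 2 * Real.sin_sq_add_cos_sq t
    have h3 : HasDerivAt
        (fun t : ℝ => c + (Real.cos t • (vec x.2 * g) + Real.sin t • (vec u * g)))
        (vec u * g) 0 := by
      have := (((Real.hasDerivAt_cos 0).smul_const (vec x.2 * g)).add
        ((Real.hasDerivAt_sin 0).smul_const (vec u * g))).const_add c
      simpa using this
    rw [h2] at h1
    exact h1.unique h3
  by_cases hw0 : w = 0
  · rw [hw0, vec_zero, zero_mul]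
    exact map_zero _
  have hw' : ‖w‖ ≠ 0 := norm_ne_zero_iff.2 hw0
  have h := key ((‖x.2‖ / ‖w‖) • w) (by rw [inner_smul_right, hw, mul_zero])
    (by rw [norm_smul, norm_div, norm_norm, norm_norm, div_mul_cancel₀ _ hw'])
  have hne : ‖x.2‖ / ‖w‖ ≠ 0 := div_ne_zero hx' hw'
  rw [vec_smul, smul_mul_assoc, ← smul_zero (‖x.2‖ / ‖w‖ : ℝ), ← Prod.smul_mk, map_smul] at h
  exact smul_right_injective _ hne h

theorem fderiv_apply_of_affine_on_sphere {f : Para m → Cl m} {x : Para m} {c g : Cl m}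
    (hx : x.2 ≠ 0) (hfd : DifferentiableAt ℝ f x)
    (hf : ∀ v : V m, ‖v‖ = ‖x.2‖ → f (x.1, v) = c + vec v * g) (w : V m) :
    fderiv ℝ f x (0, w) = (inner ℝ x.2 w : ℝ) •
      ((‖x.2‖ ^ 2)⁻¹ • (fderiv ℝ f x (0, x.2) - vec x.2 * g)) + vec w * g := by
  have hx' : ‖x.2‖ ^ 2 ≠ 0 := pow_ne_zero 2 (norm_ne_zero_iff.2 hx)
  set s : ℝ := (inner ℝ x.2 w : ℝ) * (‖x.2‖ ^ 2)⁻¹ with hs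
  have h1 : inner ℝ x.2 (w - s • x.2) = 0 := by
    rw [inner_sub_right, inner_smul_right, real_inner_self_eq_norm_sq, hs, inv_mul_cancel_right₀ hx',
      sub_self]
  have h2 := fderiv_apply_of_orthogonal hx hfd hf h1
  have h3 : ((0, w) : Para m) = (0, w - s • x.2) + s • (0, x.2) := by simp
  rw [h3, map_add, map_smul, h2, smul_smul, ← hs, vec_sub, vec_smul, sub_mul, smul_mul_assoc]
  module

/-- Reflections preserve the sphere, and `x̲ - σ_α x̲` is a multiple of `α`. On the hyperplane `α`
is itself tangent to the sphere. -/
theorem diffQuot_of_affine_on_sphere {f : Para m → Cl m} {x : Para m} {c g : Cl m}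
    (hx : x.2 ≠ 0) (hfd : DifferentiableAt ℝ f x)
    (hf : ∀ v : V m, ‖v‖ = ‖x.2‖ → f (x.1, v) = c + vec v * g) (α : V m) :
    diffQuot α f x = (2 / ‖α‖ ^ 2) • (vec α * g) := by
  unfold diffQuot
  split_ifs with h
  · rw [fderiv_apply_of_orthogonal hx hfd hf (by rwa [real_inner_comm])]
  · have h1 : f x = c + vec x.2 * g := hf x.2 rfl
    rw [h1, hf _ ((refl α).norm_map _), add_sub_add_left_eq_sub, ← sub_mul, ← vec_sub, refl_apply,
      sub_sub_cancel, vec_smul, smul_mul_assoc, smul_smul]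
    congr 1
    field_simp

/-- On slice functions the Dunkl–Dirac operator acts as a radial derivative. -/
theorem dunklCR_of_affine_on_sphere (h0 : ∀ α ∈ Rp, α ≠ 0)
    (hγ : gammaIndex Rp κ = (1 - (m : ℝ)) / 2) {f : Para m → Cl m} {x : Para m} {c g : Cl m}
    (hx : x.2 ≠ 0) (hfd : DifferentiableAt ℝ f x)
    (hf : ∀ v : V m, ‖v‖ = ‖x.2‖ → f (x.1, v) = c + vec v * g) :
    dunklCR Rp κ f x =
      partial0 f x + (‖x.2‖ ^ 2)⁻¹ • (vec x.2 * fderiv ℝ f x (0, x.2)) := by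
  have hx' : ‖x.2‖ ^ 2 ≠ 0 := pow_ne_zero 2 (norm_ne_zero_iff.2 hx)
  rw [dunklCR_eq_of_fderiv h0 hγ (fderiv_apply_of_affine_on_sphere hx hfd hf)
    fun α _ => diffQuot_of_affine_on_sphere hx hfd hf α]
  rw [mul_smul_comm, mul_sub, vec_mul_vec_mul, smul_sub, smul_smul, mul_neg, inv_mul_cancel₀ hx']
  congr 1
  module

theorem IsInducedBy.affine_on_sphere {D : Set ℂ} (hsymm : ∀ z ∈ D, starRingEnd ℂ z ∈ D)
    {F : ℂ → Cl m × Cl m} {f : Para m → Cl m} (hF : IsStem D F) (hf : IsInducedBy D F f)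
    {ω : V m} (hω : ‖ω‖ = 1) {z : ℂ} (hz : z ∈ D) (hz0 : z.im ≠ 0) (v : V m)
    (hv : ‖v‖ = ‖(plane ω z).2‖) :
    f ((plane ω z).1, v) = (F z).1 + vec v * (z.im⁻¹ • (F z).2) := by
  have hz' : |z.im| ≠ 0 := abs_ne_zero.2 hz0
  rw [plane_apply, norm_smul, hω, mul_one, Real.norm_eq_abs] at hv
  -- Dividing by `z.im` with its sign, not by the norm, handles both half planes at once.
  have h := hf.plane_eq hsymm hF (ω := z.im⁻¹ • v)
    (by rw [norm_smul, norm_inv, Real.norm_eq_abs, hv, inv_mul_cancel₀ hz']) hz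
  rw [plane_apply, smul_inv_smul₀ hz0, vec_smul, smul_mul_assoc, ← mul_smul_comm] at h
  exact h

/-- Both factors `x̲` equal `z.im • ω`, so the second term is `ω ∂_ω f`; multiplication by `ω`
passes between the two equations. -/
theorem isSliceHolomorphicAt_iff {f : Para m → Cl m} {ω : V m} (hω : ‖ω‖ = 1) {z : ℂ}
    (hz0 : z.im ≠ 0) : IsSliceHolomorphicAt f ω z ↔
      partial0 f (plane ω z) + (‖(plane ω z).2‖ ^ 2)⁻¹ •
        (vec (plane ω z).2 * fderiv ℝ f (plane ω z) (0, (plane ω z).2)) = 0 := by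
  have h1 : ((0, (plane ω z).2) : Para m) = z.im • (0, ω) := by simp [plane_apply]
  have h2 : ‖(plane ω z).2‖ ^ 2 = z.im * z.im := by
    rw [plane_apply, norm_smul, hω, mul_one, Real.norm_eq_abs, sq_abs, sq]
  have h3 : vec (plane ω z).2 = z.im • (vec ω : Cl m) := by rw [plane_apply, vec_smul]
  have h4 : z.im * z.im ≠ 0 := mul_ne_zero hz0 hz0
  rw [h1, h2, h3, map_smul, smul_mul_smul_comm, inv_smul_smul₀ h4, partial0, IsSliceHolomorphicAt]
  constructor
  · intro h
    rw [h, vec_mul_vec_mul_of_norm_eq_one hω, add_neg_cancel]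
  · intro h
    rw [eq_neg_of_add_eq_zero_left h, mul_neg, vec_mul_vec_mul_of_norm_eq_one hω, neg_neg]

/-- The Dunkl–Cauchy–Riemann operator at the real points of a slice holomorphic function. -/
theorem dunklCR_eq_zero_of_real (hm : m ≠ 0) (h0 : ∀ α ∈ Rp, α ≠ 0)
    (hγ : gammaIndex Rp κ = (1 - (m : ℝ)) / 2) {f : Para m → Cl m} {x : Para m} (hx : x.2 = 0)
    (h : ∀ ω : V m, ‖ω‖ = 1 → fderiv ℝ f x (0, ω) = vec ω * fderiv ℝ f x (1, 0)) :
    dunklCR Rp κ f x = 0 := by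
  have h1 : ∀ w : V m, fderiv ℝ f x (0, w) = vec w * fderiv ℝ f x (1, 0) := by
    intro w
    obtain ⟨ω, hω, hw⟩ := exists_norm_smul_eq hm w
    rw [hw, vec_smul, smul_mul_assoc, ← h ω hω, ← map_smul, Prod.smul_mk, smul_zero]
  -- At `x̲ = 0` there is no radial term, and every difference quotient takes its limit value.
  rw [dunklCR_eq_of_fderiv h0 hγ (A := 0) (g := fderiv ℝ f x (1, 0))]
  · rw [partial0, mul_zero, zero_sub, add_neg_cancel]
  · simpa using h1
  · intro α _
    rw [diffQuot, if_pos (by rw [hx, inner_zero_right]), h1]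

theorem dunklCR_eq_polar (f : Para m → Cl m) {x : Para m} (hx : x.2 ≠ 0) :
    dunklCR Rp κ f x = partial0 f x + (‖x.2‖ ^ 2)⁻¹ •
      (vec x.2 * (fderiv ℝ f x (0, x.2) + dunklSphericalDirac Rp κ f x)) := by
  have hx' : ‖x.2‖ ^ 2 ≠ 0 := pow_ne_zero 2 (norm_ne_zero_iff.2 hx)
  rw [← neg_neg (fderiv ℝ f x (0, x.2) + _), ← vec_mul_dunklDirac, mul_neg, vec_mul_vec_mul,
    neg_smul, neg_neg, inv_smul_smul₀ hx', dunklCR]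

theorem plane_snd_ne_zero {ω : V m} (hω : ‖ω‖ = 1) {z : ℂ} :
    (plane ω z).2 ≠ 0 ↔ z.im ≠ 0 := by
  have : ω ≠ 0 := by rintro rfl; simp at hω
  simp [plane_apply, this]

theorem IsSlice.dunklCR_eq {D : Set ℂ} (hsymm : ∀ z ∈ D, starRingEnd ℂ z ∈ D)
    (h0 : ∀ α ∈ Rp, α ≠ 0) (hγ : gammaIndex Rp κ = (1 - (m : ℝ)) / 2) {f : Para m → Cl m}
    (hf : IsSlice D f) {x : Para m} (hxD : x ∈ circ m D) (hx : x.2 ≠ 0)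
    (hfd : DifferentiableAt ℝ f x) :
    dunklCR Rp κ f x =
      partial0 f x + (‖x.2‖ ^ 2)⁻¹ • (vec x.2 * fderiv ℝ f x (0, x.2)) := by
  obtain ⟨F, hF, hfF⟩ := hf
  obtain ⟨ω, hω, z, hz, rfl⟩ := exists_plane_of_mem_circ hxD
  exact dunklCR_of_affine_on_sphere h0 hγ hx hfd
    (hfF.affine_on_sphere hsymm hF hω hz ((plane_snd_ne_zero hω).1 hx))

/-- The Dunkl-spherical Dirac operator annihilates slice functions. -/
theorem IsSlice.dunklSphericalDirac_eq_zero {D : Set ℂ} (hsymm : ∀ z ∈ D, starRingEnd ℂ z ∈ D)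
    (h0 : ∀ α ∈ Rp, α ≠ 0) (hγ : gammaIndex Rp κ = (1 - (m : ℝ)) / 2) {f : Para m → Cl m}
    (hf : IsSlice D f) {x : Para m} (hxD : x ∈ circ m D) (hx : x.2 ≠ 0)
    (hfd : DifferentiableAt ℝ f x) : dunklSphericalDirac Rp κ f x = 0 := by
  have hx' : ‖x.2‖ ^ 2 ≠ 0 := pow_ne_zero 2 (norm_ne_zero_iff.2 hx)
  have h := (dunklCR_eq_polar (Rp := Rp) (κ := κ) f hx).symm.trans
    (hf.dunklCR_eq hsymm h0 hγ hxD hx hfd)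
  -- The common terms cancel and leave `x̲ Γ̃ f = 0`, with `x̲` invertible.
  rw [mul_add, smul_add, ← add_assoc, add_eq_left] at h
  have h' := (smul_eq_zero.1 h).resolve_left (inv_ne_zero hx')
  have h'' := vec_mul_vec_mul x.2 (dunklSphericalDirac Rp κ f x)
  rw [h', mul_zero] at h''
  exact (smul_eq_zero.1 h''.symm).resolve_left (neg_ne_zero.2 hx')

theorem IsSliceRegular.dunklCR_eq_zero (hm : m ≠ 0) {D : Set ℂ} (hD : IsOpen D)
    (hsymm : ∀ z ∈ D, starRingEnd ℂ z ∈ D)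
    (h0 : ∀ α ∈ Rp, α ≠ 0) (hγ : gammaIndex Rp κ = (1 - (m : ℝ)) / 2) {f : Para m → Cl m}
    (hf : IsSliceRegular D f) {x : Para m} (hxD : x ∈ circ m D) (hfd : DifferentiableAt ℝ f x) :
    dunklCR Rp κ f x = 0 := by
  by_cases hx : x.2 = 0
  · refine dunklCR_eq_zero_of_real hm h0 hγ hx fun ω hω => ?_
    have h1 : plane ω (x.1 : ℂ) = x := by
      rw [plane_apply, Complex.ofReal_re, Complex.ofReal_im, zero_smul, ← hx]
    have h2 : (x.1 : ℂ) ∈ D := by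
      have := (mem_circ_iff hm hsymm x).1 hxD
      rwa [hx, norm_zero] at this
    have h3 := hf.isSliceHolomorphicAt hD hsymm hω h2 (by rwa [h1])
    rwa [IsSliceHolomorphicAt, h1] at h3
  · rw [hf.isSlice.dunklCR_eq hsymm h0 hγ hxD hx hfd]
    obtain ⟨ω, hω, z, hz, rfl⟩ := exists_plane_of_mem_circ hxD
    exact (isSliceHolomorphicAt_iff hω ((plane_snd_ne_zero hω).1 hx)).1
      (hf.isSliceHolomorphicAt hD hsymm hω hz hfd)

theorem IsSlice.isSliceRegular {D : Set ℂ} (hm : m ≠ 0)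
    (hsymm : ∀ z ∈ D, starRingEnd ℂ z ∈ D) {f : Para m → Cl m}
    (hf : IsSlice D f) (hfd : ∀ x ∈ circ m D, DifferentiableAt ℝ f x)
    (h : ∀ ω : V m, ‖ω‖ = 1 → ∀ z ∈ D, IsSliceHolomorphicAt f ω z) : IsSliceRegular D f := by
  obtain ⟨F, hF, hfF⟩ := hf
  obtain ⟨J, hJ, -⟩ := exists_norm_smul_eq hm 0
  refine ⟨planeStem f J, isStem_planeStem D f J, isHolomorphicStem_planeStem hfd hJ h, ?_⟩
  intro a r ω hr hω hz
  rw [planeStem_of_isInducedBy hsymm hF hfF hJ hz]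
  exact hfF a r ω hr hω hz

end SliceDunkl

end

end DunklSlice

/-! ### The two characterizations of slice regularity -/

open DunklSlice
theorem theorem3 (m : ℕ) (R Rp : Finset (V m)) (hR : IsRootSystem R)
    (hRp : IsPositiveSubsystem R Rp) (κ : V m → ℝ) (hκ : IsMultiplicity R κ)
    (hγ : gammaIndex Rp κ = (1 - (m : ℝ)) / 2) (hsing : κ ∉ singularSet R Rp)
    (D : Set ℂ) (hD : IsOpen D) (hsymm : ∀ z ∈ D, starRingEnd ℂ z ∈ D) :
    (∀ f : Para m → Cl m, ContDiffOn ℝ 1 f (circ m D) → IsSlice D f →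
      (IsSliceRegular D f ↔ ∀ x ∈ circ m D, dunklCR Rp κ f x = 0)) ∧
    ((∃ t : ℝ, ((t, 0) : Para m) ∈ circ m D) →
      (∀ z ∈ D, ∃ t : ℝ, (t : ℂ) ∈ connectedComponentIn D z) →
      ∀ f : Para m → Cl m, ContDiffOn ℝ 1 f (circ m D) →
        (IsSliceRegular D f ↔
          (∀ x ∈ circ m D, dunklCR Rp κ f x = 0) ∧
          (∀ x ∈ circ m D, x.2 ≠ 0 → dunklSphericalDirac Rp κ f x = 0))) := by
  have h0 : ∀ α ∈ Rp, α ≠ 0 := by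
    rintro α hα rfl
    have : (0 : V m) ∈ (R : Set (V m)) := by
      rw [hRp.union]
      exact Or.inl hα
    exact hR.zero_notMem this
  -- For `m = 0` there are no roots, so `γ_κ = 0`, whereas the hypothesis would require `1/2`.
  have hm : m ≠ 0 := by
    rintro rfl
    have hsum : gammaIndex Rp κ = 0 :=
      Finset.sum_eq_zero fun α hα => absurd (Subsingleton.elim α 0) (h0 α hα)
    rw [hsum] at hγ
    norm_num at hγ
  have ho := isOpen_circ hm hD hsymm
  have hdiff : ∀ f : Para m → Cl m, ContDiffOn ℝ 1 f (circ m D) →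
      ∀ x ∈ circ m D, DifferentiableAt ℝ f x := fun f hf x hx =>
    (hf.differentiableOn one_ne_zero).differentiableAt (ho.mem_nhds hx)
  have hext : ∀ f : Para m → Cl m, ContDiffOn ℝ 1 f (circ m D) →
      (∀ x ∈ circ m D, x.2 ≠ 0 →
        partial0 f x + (‖x.2‖ ^ 2)⁻¹ • (vec x.2 * fderiv ℝ f x (0, x.2)) = 0) →
      ∀ ω : V m, ‖ω‖ = 1 → ∀ z ∈ D, IsSliceHolomorphicAt f ω z := by
    intro f hf h ω hω z hz
    refine isSliceHolomorphicAt_of_im_ne_zero hD hω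
      (hf.continuousOn_fderiv_of_isOpen ho le_rfl) ho (fun y hy hy0 => ?_) hz
    exact (isSliceHolomorphicAt_iff hω hy0).2
      (h _ (plane_mem_circ hω hy) ((plane_snd_ne_zero hω).2 hy0))
  refine ⟨fun f hf hs => ⟨fun h x hx =>
    h.dunklCR_eq_zero hm hD hsymm h0 hγ hx (hdiff f hf x hx), fun h => ?_⟩,
    fun _ hcc f hf => ⟨fun h => ⟨fun x hx =>
      h.dunklCR_eq_zero hm hD hsymm h0 hγ hx (hdiff f hf x hx), fun x hx hx0 =>
      h.isSlice.dunklSphericalDirac_eq_zero hsymm h0 hγ hx hx0 (hdiff f hf x hx)⟩, ?_⟩⟩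
  · refine hs.isSliceRegular hm hsymm (hdiff f hf) (hext f hf fun x hx hx0 => ?_)
    rw [← hs.dunklCR_eq hsymm h0 hγ hx hx0 (hdiff f hf x hx), h x hx]
  · rintro ⟨h1, h2⟩
    obtain ⟨J, hJ, -⟩ := exists_norm_smul_eq hm 0
    -- With `Γ̃ f = 0` the polar form of `D_h f = 0` is the Cauchy–Riemann equation on the plane of
    -- `x`.
    have hhol := hext f hf fun x hx hx0 => by
      have := dunklCR_eq_polar (Rp := Rp) (κ := κ) f hx0
      rw [h1 x hx, h2 x hx hx0, add_zero] at this
      exact this.symm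
    exact ⟨planeStem f J, isStem_planeStem D f J,
      isHolomorphicStem_planeStem (hdiff f hf) hJ hhol,
      isInducedBy_planeStem hD hcc (hdiff f hf) hJ hhol⟩
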